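/- For a positive integer $r$ and a finite graph $G$ with degrees $d_1,\dots,d_n$, let $e_r(G)=\sum_{i=1}^n d_i^r$, and let $\mathrm{ex}_r(n,F)$ be the largest value of $e_r(G)$ among $n$-vertex graphs $G$ that do not contain $F$ as a (not necessarily induced) subgraph. Let $r,s,t$ be integers with $1<s\le t<r$. Then there is an $n_0=n_0(r,s,t)$ such that for all $n\ge n_0$ the following holds. There exists a graph $G_0$ on $n-s+1$ vertices with girth at least $5$ (acyclic graphs having infinite girth) in which each vertex has degree $t-1$, except for at most one vertex, which has degree $t-2$. Moreover, for every such $G_0$, if $H'(s-1,t-1,n)$ denotes the $n$-vertex graph obtained from the join of $K_{s-1}$ and the empty graph on $n-s+1$ vertices by placing $G_0$ on the independent set of $n-s+1$ vertices, then $$\mathrm{ex}_r(n,K_{s,t})=e_r(H'(s-1,t-1,n)).$$ -/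

import Mathlib

noncomputable section

namespace DegreePowers

open scoped Classical in
/-- The degree power sum `e_r(G) = ∑ d_i ^ r`, where `d_1, …, d_n` are the degrees of `G`. -/
def degreePowerSum (r : ℕ) {V : Type*} [Fintype V] (G : SimpleGraph V) : ℕ :=
  ∑ v : V, G.degree v ^ r

open scoped Classical in
/-- `ex_r(n, F)`: the largest value of `e_r(G)` among the `F`-free graphs `G` on `n` vertices
(`F` need not be induced). -/
def exDegreePower (r n : ℕ) {W : Type*} (F : SimpleGraph W) : ℕ :=
  ({G : SimpleGraph (Fin n) | F.Free G} : Finset (SimpleGraph (Fin n))).sup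
    fun G => degreePowerSum r G

/-- The join of two graphs: their disjoint union together with all edges between the two. -/
def join {V W : Type*} (G : SimpleGraph V) (H : SimpleGraph W) : SimpleGraph (V ⊕ W) :=
  G.sum H ⊔ completeBipartiteGraph V W

/-- `H(a, n)`: the join of `K_a` and the empty graph on `n - a` vertices (used for `a ≤ n`). -/
def graphH (a n : ℕ) : SimpleGraph (Fin a ⊕ Fin (n - a)) :=
  join (⊤ : SimpleGraph (Fin a)) (⊥ : SimpleGraph (Fin (n - a)))

/-- `H(a, n)` with the edges of a graph `G₀` added on its independent set of order `n - a`. -/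
def graphHPrime (a n : ℕ) (G₀ : SimpleGraph (Fin (n - a))) :
    SimpleGraph (Fin a ⊕ Fin (n - a)) :=
  graphH a n ⊔ G₀.map Function.Embedding.inr

open scoped Classical in
/-- `G` has girth at least `5` (a graph without cycles has infinite girth), and every vertex of
`G` has degree `d`, except for at most one vertex, which has degree `d - 1`
(used for `1 ≤ d`). -/
def IsAlmostRegularGirthFive (d : ℕ) {V : Type*} [Fintype V] (G : SimpleGraph V) : Prop :=
  5 ≤ G.egirth ∧
    ((∀ v, G.degree v = d) ∨ ∃ u, G.degree u = d - 1 ∧ ∀ v, v ≠ u → G.degree v = d)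

end DegreePowers

end

/-! Existence of `G₀`: with d = t - 1, take a graph without 3- or 4-cycles, of maximum degree at
most d, whose degree sum is maximal. If its total deficiency were at least 2, at vertices x and y
(possibly equal), choose u far from both. Either u has spare degree and the edge xu can be added, or
some edge uv can be replaced by xu and yv (`exists_sum_degree_lt`). Both keep the girth condition
and raise the degree sum.

Upper bound: let U be the set of vertices of degree at least (1 - 1/M)n, for a large constant M.
Being `K_{s,t}`-free forces #U < s. If #U < s - 1, then in a count of stars with t leaves at least
one share of n^r loses a factor 1 - 1/M, which outweighs all errors of order n^(r-1)
(`NoBiclique.degreePowerSum_le_of_card_lt`). If #U = s - 1 and b > 0 vertices outside U miss some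
vertex of U, the powers over U drop by at least b(n-1)^(r-1). The vertices outside U contribute only
O(n + b^r), which is smaller since b is at most sn/M (`NoBiclique.degreePowerSum_le_of_deficient`).
If b = 0, each vertex outside U has at most t - 1 neighbours outside U, and parity of the degree sum
decides whether one must have fewer (`NoBiclique.degreePowerSum_le_of_deficient_eq_empty`).

Lower bound: `graphHPrime_free` shows that the construction itself is `K_{s,t}`-free. -/

namespace DegreePowers
open SimpleGraph Finset
open scoped Classical

/-! ### Almost regular graphs of girth at least 5 -/

section Girth
variable {V : Type*}

/-- `G` has neither a triangle nor a `4`-cycle. -/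
structure NoShortCycle (G : SimpleGraph V) : Prop where
  triangle : ∀ a b c, G.Adj a b → G.Adj b c → G.Adj c a → False
  square : ∀ a b c d, G.Adj a b → G.Adj b c → G.Adj c d → G.Adj d a → a ≠ c → b ≠ d → False

lemma NoShortCycle.five_le_egirth {G : SimpleGraph V} (h : NoShortCycle G) : 5 ≤ G.egirth := by
  rw [le_egirth]
  intro a w hw
  have h3 := hw.three_le_length
  by_contra! hlt
  have hlt : w.length < 5 := by exact_mod_cast hlt
  match w, hw with
  | .nil, hw => simp at h3
  | .cons _ .nil, hw => simp at h3
  | .cons _ (.cons _ .nil), hw => simp at h3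
  | .cons h1 (.cons h2 (.cons h3 .nil)), hw => exact h.triangle _ _ _ h1 h2 h3
  | .cons h1 (.cons h2 (.cons h3 (.cons h4 .nil))), hw =>
    refine h.square _ _ _ _ h1 h2 h3 h4 ?_ ?_
    · have := hw.support_nodup
      simp at this
      grind
    · have := hw.support_nodup
      simp at this
      grind
  | .cons _ (.cons _ (.cons _ (.cons _ (.cons _ _)))), hw => simp at hlt; omega

lemma noShortCycle_of_five_le_egirth {G : SimpleGraph V} (h : 5 ≤ G.egirth) : NoShortCycle G := by
  rw [le_egirth] at h
  constructor
  · intro a b c hab hbc hca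
    have hc : (Walk.cons hab (.cons hbc (.cons hca .nil))).IsCycle := by
      have := hab.ne; have := hbc.ne; have := hca.ne
      simp [Walk.cons_isCycle_iff]
      grind
    have := h _ _ hc
    simp at this
    exact absurd this (by decide)
  · intro a b c d hab hbc hcd hda hac hbd
    have hc : (Walk.cons hab (.cons hbc (.cons hcd (.cons hda .nil)))).IsCycle := by
      have := hab.ne; have := hbc.ne; have := hcd.ne; have := hda.ne
      simp [Walk.cons_isCycle_iff]
      grind
    have := h _ _ hc
    simp at this
    exact absurd this (by decide)

/-- `b` is at distance at most `3` from `a`. -/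
def WithinThree (G : SimpleGraph V) (a b : V) : Prop :=
  ∃ p q, (a = p ∨ G.Adj a p) ∧ (p = q ∨ G.Adj p q) ∧ (q = b ∨ G.Adj q b)

lemma NoShortCycle.mono {G H : SimpleGraph V} (hG : NoShortCycle G) (h : H ≤ G) :
    NoShortCycle H :=
  ⟨fun a b c h1 h2 h3 => hG.triangle a b c (h h1) (h h2) (h h3),
   fun a b c d h1 h2 h3 h4 => hG.square a b c d (h h1) (h h2) (h h3) (h h4)⟩

/-- The graph `G` with the edge `xu` added (if `x ≠ u`). -/
def insertEdge (G : SimpleGraph V) (x u : V) : SimpleGraph V := G ⊔ edge x u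

lemma insertEdge_adj {G : SimpleGraph V} {x u a b : V} : (insertEdge G x u).Adj a b ↔
    G.Adj a b ∨ (a = x ∧ b = u ∨ a = u ∧ b = x) ∧ a ≠ b := by
  simp [insertEdge, edge_adj]

/-- A new triangle or 4-cycle would use the new edge, and the rest of it would be a path of length
at most 3 from x to u. -/
lemma NoShortCycle.insertEdge {G : SimpleGraph V} (hG : NoShortCycle G) {x u : V}
    (hxu : ¬ WithinThree G x u) : NoShortCycle (DegreePowers.insertEdge G x u) := by
  have key : ∀ p q, (x = p ∨ G.Adj x p) → (p = q ∨ G.Adj p q) → (q = u ∨ G.Adj q u) → False :=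
    fun p q h1 h2 h3 => hxu ⟨p, q, h1, h2, h3⟩
  have hs : ∀ a b, G.Adj a b → G.Adj b a := fun a b h => h.symm
  have hi : ∀ a, ¬ G.Adj a a := fun a => G.irrefl
  constructor
  · intro a b c h1 h2 h3
    have := hG.triangle a b c
    simp only [insertEdge_adj] at h1 h2 h3
    grind
  · intro a b c d h1 h2 h3 h4 hac hbd
    have := hG.square a b c d
    simp only [insertEdge_adj] at h1 h2 h3 h4
    grind

lemma NoShortCycle.bot : NoShortCycle (⊥ : SimpleGraph V) :=
  ⟨fun _ _ _ h => by simp at h, fun _ _ _ _ h => by simp at h⟩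

lemma NoShortCycle.not_withinThree_deleteEdges {G : SimpleGraph V} (hG : NoShortCycle G) {u v : V}
    (huv : G.Adj u v) : ¬ WithinThree (G.deleteEdges {s(u, v)}) u v := by
  rintro ⟨p, q, h1, h2, h3⟩
  have hne := huv.ne
  have hvu := huv.symm
  simp only [deleteEdges_adj, Set.mem_singleton_iff, Sym2.eq_iff] at h1 h2 h3
  have h4 := hG.square u p q v
  have h5 := hG.triangle u p v
  have h6 := hG.triangle u q v
  grind

lemma WithinThree.mono {G H : SimpleGraph V} {a b : V} (h : WithinThree H a b) (hle : H ≤ G) :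
    WithinThree G a b := by
  obtain ⟨p, q, h1, h2, h3⟩ := h
  exact ⟨p, q, h1.imp id (@hle _ _), h2.imp id (@hle _ _), h3.imp id (@hle _ _)⟩

/-- The graph obtained by replacing the edge `uv` by the edges `xu` and `yv`. -/
def splice (G : SimpleGraph V) (u v x y : V) : SimpleGraph V :=
  insertEdge (insertEdge (G.deleteEdges {s(u, v)}) x u) y v

lemma splice_adj {G : SimpleGraph V} {u v x y a b : V} : (DegreePowers.splice G u v x y).Adj a b ↔
    (G.Adj a b ∧ ¬ (a = u ∧ b = v ∨ a = v ∧ b = u)) ∨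
      ((a = x ∧ b = u ∨ a = u ∧ b = x) ∧ a ≠ b) ∨ ((a = y ∧ b = v ∨ a = v ∧ b = y) ∧ a ≠ b) := by
  simp [DegreePowers.splice, insertEdge_adj, or_assoc]

variable [Fintype V]

/-- The ball of radius `k` around `x`. -/
noncomputable def nearFinset (G : SimpleGraph V) : ℕ → V → Finset V
  | 0, x => {x}
  | k + 1, x => (nearFinset G k x).biUnion fun w => insert w (G.neighborFinset w)

lemma mem_nearFinset_succ {G : SimpleGraph V} {k : ℕ} {x z : V} :
    z ∈ nearFinset G (k + 1) x ↔ ∃ w ∈ nearFinset G k x, w = z ∨ G.Adj w z := by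
  simp [nearFinset, eq_comm]

lemma card_nearFinset_le {G : SimpleGraph V} {d : ℕ} (hd : ∀ v, G.degree v ≤ d) (k : ℕ) (x : V) :
    #(nearFinset G k x) ≤ (d + 1) ^ k := by
  induction k with
  | zero => simp [nearFinset]
  | succ k ih =>
    rw [nearFinset, pow_succ]
    refine (card_biUnion_le_card_mul _ _ (d + 1) fun w _ => ?_).trans (Nat.mul_le_mul_right _ ih)
    exact (card_insert_le _ _).trans (by simpa using hd w)

lemma WithinThree.mem_nearFinset {G : SimpleGraph V} {x u : V} (h : WithinThree G x u) :
    u ∈ nearFinset G 3 x := by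
  obtain ⟨p, q, h1, h2, h3⟩ := h
  exact mem_nearFinset_succ.2 ⟨q, mem_nearFinset_succ.2 ⟨p, mem_nearFinset_succ.2
    ⟨x, by simp [nearFinset], h1⟩, h2⟩, h3⟩

lemma mem_nearFinset_of_adj {G : SimpleGraph V} {k : ℕ} {x u v : V} (h : v ∈ nearFinset G k x)
    (huv : G.Adj u v) : u ∈ nearFinset G (k + 1) x :=
  mem_nearFinset_succ.2 ⟨v, h, .inr huv.symm⟩

lemma mem_nearFinset_mono {G : SimpleGraph V} {k : ℕ} {x u : V} (h : u ∈ nearFinset G k x) :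
    u ∈ nearFinset G (k + 1) x :=
  mem_nearFinset_succ.2 ⟨u, h, .inl rfl⟩

/-- Radius 4 is used so that v, a neighbour of u, is still at distance more than 3 from x and y. -/
lemma NoShortCycle.splice {G : SimpleGraph V} (hG : NoShortCycle G) {u v x y : V}
    (huv : G.Adj u v) (hx : u ∉ nearFinset G 4 x) (hy : u ∉ nearFinset G 4 y) :
    NoShortCycle (splice G u v x y) := by
  have hle : G.deleteEdges {s(u, v)} ≤ G := deleteEdges_le _
  set H := G.deleteEdges {s(u, v)} with hH
  have far : ∀ z, u ∉ nearFinset G 4 z → ¬ WithinThree H z u ∧ ¬ WithinThree H z v :=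
    fun z hz => ⟨fun h => hz (mem_nearFinset_mono (h.mono hle).mem_nearFinset),
      fun h => hz (mem_nearFinset_of_adj (h.mono hle).mem_nearFinset huv)⟩
  have key : ∀ {a b}, ¬ WithinThree H a b →
      ∀ p q, (a = p ∨ H.Adj a p) → (p = q ∨ H.Adj p q) → (q = b ∨ H.Adj q b) → False :=
    fun h p q h1 h2 h3 => h ⟨p, q, h1, h2, h3⟩
  -- It remains to exclude a short path from y to v after xu is added. If it uses xu, a part of it
  -- joins u to v or x to v within distance 3 in `H`; otherwise it joins y to v there.
  refine ((hG.mono hle).insertEdge (far x hx).1).insertEdge ?_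
  have hxu := key (far x hx).1
  have hxv := key (far x hx).2
  have hyu := key (far y hy).1
  have hyv := key (far y hy).2
  have huv' := key (hG.not_withinThree_deleteEdges huv)
  have hs : ∀ a b, H.Adj a b → H.Adj b a := fun a b h => h.symm
  have hi : ∀ a, ¬ H.Adj a a := fun a => H.irrefl
  rintro ⟨p, q, h1, h2, h3⟩
  simp only [insertEdge_adj] at h1 h2 h3
  grind

lemma degree_splice {G : SimpleGraph V} {u v x y : V} (huv : G.Adj u v)
    (hx : u ∉ nearFinset G 4 x) (hy : u ∉ nearFinset G 4 y) :
    (∀ w, w ≠ x → w ≠ y → (splice G u v x y).degree w = G.degree w) ∧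
      (x ≠ y → (splice G u v x y).degree x = G.degree x + 1 ∧
        (splice G u v x y).degree y = G.degree y + 1) ∧
      (x = y → (splice G u v x y).degree x = G.degree x + 2) := by
  have far : ∀ z, u ∉ nearFinset G 4 z → z ≠ u ∧ z ≠ v ∧ ¬ G.Adj z u ∧ ¬ G.Adj z v := by
    intro z hz
    have h0 : z ∈ nearFinset G 0 z := by simp [nearFinset]
    have step : ∀ {k a b}, a ∈ nearFinset G k z → G.Adj a b → b ∈ nearFinset G (k + 1) z :=
      fun h h' => mem_nearFinset_of_adj h h'.symm
    refine ⟨?_, ?_, ?_, ?_⟩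
    · rintro rfl
      exact hz (mem_nearFinset_mono (mem_nearFinset_mono (mem_nearFinset_mono
        (mem_nearFinset_mono h0))))
    · rintro rfl
      exact hz (mem_nearFinset_mono (mem_nearFinset_mono (mem_nearFinset_mono
        (step h0 huv.symm))))
    · exact fun h => hz (mem_nearFinset_mono (mem_nearFinset_mono (mem_nearFinset_mono
        (step h0 h))))
    · exact fun h => hz (mem_nearFinset_mono (mem_nearFinset_mono (step (step h0 h) huv.symm)))
  obtain ⟨hxu, hxv, hnxu, hnxv⟩ := far x hx
  obtain ⟨hyu, hyv, hnyu, hnyv⟩ := far y hy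
  have hne := huv.ne
  have hvu := huv.symm
  have hs : ∀ a b, G.Adj a b → G.Adj b a := fun a b h => h.symm
  simp only [← card_neighborFinset_eq_degree]
  refine ⟨fun w hwx hwy => ?_, fun hxy => ⟨?_, ?_⟩, ?_⟩
  · by_cases hwu : w = u
    · subst hwu
      have : (splice G w v x y).neighborFinset w = insert x ((G.neighborFinset w).erase v) := by
        ext z
        simp only [mem_neighborFinset, splice_adj, mem_insert, mem_erase]
        grind
      rw [this, card_insert_of_notMem (by simp; grind), card_erase_of_mem (by simpa)]
      have : 0 < #(G.neighborFinset w) := card_pos.2 ⟨v, by simpa⟩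
      omega
    by_cases hwv : w = v
    · subst hwv
      have : (splice G u w x y).neighborFinset w = insert y ((G.neighborFinset w).erase u) := by
        ext z
        simp only [mem_neighborFinset, splice_adj, mem_insert, mem_erase]
        grind
      rw [this, card_insert_of_notMem (by simp; grind), card_erase_of_mem (by simpa)]
      have : 0 < #(G.neighborFinset w) := card_pos.2 ⟨u, by simpa⟩
      omega
    congr 1
    ext z
    simp only [mem_neighborFinset, splice_adj]
    grind
  · have : (splice G u v x y).neighborFinset x = insert u (G.neighborFinset x) := by
      ext z
      simp only [mem_neighborFinset, splice_adj, mem_insert]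
      grind
    rw [this, card_insert_of_notMem (by simpa)]
  · have : (splice G u v x y).neighborFinset y = insert v (G.neighborFinset y) := by
      ext z
      simp only [mem_neighborFinset, splice_adj, mem_insert]
      grind
    rw [this, card_insert_of_notMem (by simpa)]
  · rintro rfl
    have : (splice G u v x x).neighborFinset x = insert u (insert v (G.neighborFinset x)) := by
      ext z
      simp only [mem_neighborFinset, splice_adj, mem_insert]
      grind
    rw [this, card_insert_of_notMem (by simp; grind), card_insert_of_notMem (by simpa)]

lemma degree_insertEdge {G : SimpleGraph V} {x u : V} (hne : x ≠ u) (hxu : ¬ G.Adj x u) :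
    (∀ w, w ≠ x → w ≠ u → (insertEdge G x u).degree w = G.degree w) ∧
      (insertEdge G x u).degree x = G.degree x + 1 ∧ (insertEdge G x u).degree u = G.degree u + 1 := by
  have hs : ∀ a b, G.Adj a b → G.Adj b a := fun a b h => h.symm
  simp only [← card_neighborFinset_eq_degree]
  refine ⟨fun w hwx hwu => ?_, ?_, ?_⟩
  · congr 1
    ext z
    simp only [mem_neighborFinset, insertEdge_adj]
    grind
  · have : (insertEdge G x u).neighborFinset x = insert u (G.neighborFinset x) := by
      ext z
      simp only [mem_neighborFinset, insertEdge_adj, mem_insert]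
      grind
    rw [this, card_insert_of_notMem (by simpa)]
  · have : (insertEdge G x u).neighborFinset u = insert x (G.neighborFinset u) := by
      ext z
      simp only [mem_neighborFinset, insertEdge_adj, mem_insert]
      grind
    rw [this, card_insert_of_notMem (by simp; grind)]

/-- A graph of girth at least `5` and maximum degree at most `d` on sufficiently many vertices whose
total degree deficiency is at least `2` can be modified so that the degree sum increases. -/
lemma exists_sum_degree_lt {G : SimpleGraph V} {d : ℕ} (hd : 1 ≤ d) (hG : NoShortCycle G)
    (hdeg : ∀ v, G.degree v ≤ d) (hV : 2 * (d + 1) ^ 4 < Fintype.card V) {x y : V}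
    (hx : G.degree x < d) (hy : G.degree y < d) (hxy : x = y → G.degree x + 2 ≤ d) :
    ∃ G' : SimpleGraph V, NoShortCycle G' ∧ (∀ v, G'.degree v ≤ d) ∧
      ∑ v, G.degree v < ∑ v, G'.degree v := by
  obtain ⟨u, hu⟩ : ∃ u, u ∉ nearFinset G 4 x ∪ nearFinset G 4 y := by
    by_contra! h
    have h1 : Fintype.card V ≤ #(nearFinset G 4 x ∪ nearFinset G 4 y) :=
      card_le_card fun v _ => h v
    have h2 := card_union_le (nearFinset G 4 x) (nearFinset G 4 y)
    have h3 := card_nearFinset_le hdeg 4 x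
    have h4 := card_nearFinset_le hdeg 4 y
    omega
  rw [mem_union, not_or] at hu
  obtain ⟨hux, huy⟩ := hu
  -- A saturated u has a neighbour v because d ≥ 1, and splicing the edge uv leaves the degrees of u
  -- and v unchanged.
  by_cases hud : G.degree u < d
  · have hw : ¬ WithinThree G x u := fun h => hux (mem_nearFinset_mono h.mem_nearFinset)
    have hne : x ≠ u := fun h => hw ⟨x, x, .inl rfl, .inl rfl, .inl h⟩
    have hadj : ¬ G.Adj x u := fun h => hw ⟨x, x, .inl rfl, .inl rfl, .inr h⟩
    obtain ⟨h1, h2, h3⟩ := degree_insertEdge hne hadj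
    refine ⟨insertEdge G x u, hG.insertEdge hw, fun w => ?_, sum_lt_sum (fun w _ => ?_)
      ⟨x, mem_univ _, by omega⟩⟩
    all_goals
      have := hdeg w
      by_cases hwx : w = x
      · subst hwx; omega
      by_cases hwu : w = u
      · subst hwu; omega
      have := h1 w hwx hwu
      omega
  · obtain ⟨v, hv⟩ : ∃ v, G.Adj u v := by
      have : 0 < #(G.neighborFinset u) := by rw [card_neighborFinset_eq_degree]; omega
      obtain ⟨v, hv⟩ := card_pos.1 this
      exact ⟨v, by simpa using hv⟩
    obtain ⟨h1, h2, h3⟩ := degree_splice hv hux huy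
    refine ⟨splice G u v x y, hG.splice hv hux huy, fun w => ?_, sum_lt_sum (fun w _ => ?_)
      ⟨x, mem_univ _, ?_⟩⟩
    rotate_right
    · by_cases h : x = y
      · have := h3 h; omega
      · have := h2 h; omega
    all_goals
      have := hdeg w
      by_cases hwx : w = x
      · subst hwx
        by_cases h : w = y
        · have := h3 h; have := hxy h; omega
        · have := h2 h; omega
      by_cases hwy : w = y
      · subst hwy
        have := h2 (Ne.symm hwx); omega
      have := h1 w hwx hwy
      omega

theorem exists_isAlmostRegularGirthFive {d : ℕ} (hd : 1 ≤ d)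
    (hV : 2 * (d + 1) ^ 4 < Fintype.card V) :
    ∃ G : SimpleGraph V, IsAlmostRegularGirthFive d G := by
  obtain ⟨G, hG, hmax⟩ := exists_max_image
    ({G | NoShortCycle G ∧ ∀ v, G.degree v ≤ d} : Finset (SimpleGraph V))
    (fun G => ∑ v, G.degree v) ⟨⊥, by simp [NoShortCycle.bot]⟩
  simp only [mem_filter, mem_univ, true_and] at hG hmax
  obtain ⟨hG, hdeg⟩ := hG
  have hno : ∀ x y, G.degree x < d → G.degree y < d → x = y ∧ d < G.degree x + 2 := by
    intro x y hx hy
    by_contra hcon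
    obtain ⟨G', h1, h2, h3⟩ := exists_sum_degree_lt hd hG hdeg hV hx hy (by grind)
    exact absurd (hmax G' ⟨h1, h2⟩) (not_le.2 h3)
  refine ⟨G, hG.five_le_egirth, ?_⟩
  by_cases hall : ∀ v, G.degree v = d
  · left
    convert hall
  right
  push Not at hall
  obtain ⟨u, hu⟩ := hall
  have hu' : G.degree u < d := lt_of_le_of_ne (hdeg u) hu
  refine ⟨u, ?_, fun v hv => ?_⟩
  · have := (hno u u hu' hu').2
    have : G.degree u = d - 1 := by omega
    convert this
  · have : G.degree v = d := by
      by_contra h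
      exact hv (hno v u (lt_of_le_of_ne (hdeg v) h) hu').1
    convert this

end Girth

/-! ### Degrees and `K_{s,t}`-freeness of the extremal graph -/

section JoinGraph

lemma degreePowerSum_congr (r : ℕ) {V W : Type*} [Fintype V] [Fintype W] {G : SimpleGraph V}
    {H : SimpleGraph W} (e : G ≃g H) : degreePowerSum r G = degreePowerSum r H :=
  Fintype.sum_equiv e.toEquiv _ _ fun v => by
    congr 1
    exact (Iso.degree_eq e v).symm

variable {a n : ℕ} {G₀ : SimpleGraph (Fin (n - a))}

lemma graphHPrime_adj_inl_inl {i j : Fin a} :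
    (graphHPrime a n G₀).Adj (.inl i) (.inl j) ↔ i ≠ j := by
  simp [graphHPrime, graphH, join]

lemma graphHPrime_adj_inl_inr {i : Fin a} {j : Fin (n - a)} :
    (graphHPrime a n G₀).Adj (.inl i) (.inr j) := by
  simp [graphHPrime, graphH, join]

lemma graphHPrime_adj_inr_inl {i : Fin a} {j : Fin (n - a)} :
    (graphHPrime a n G₀).Adj (.inr j) (.inl i) :=
  graphHPrime_adj_inl_inr.symm

lemma graphHPrime_adj_inr_inr {i j : Fin (n - a)} :
    (graphHPrime a n G₀).Adj (.inr i) (.inr j) ↔ G₀.Adj i j := by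
  simp [graphHPrime, graphH, join]

lemma graphHPrime_degree_inl (han : a ≤ n) (i : Fin a) :
    (graphHPrime a n G₀).degree (.inl i) = n - 1 := by
  have : (graphHPrime a n G₀).neighborFinset (.inl i) = univ.erase (.inl i) := by
    ext v
    rcases v with j | j
    · simp [graphHPrime_adj_inl_inl, eq_comm]
    · simp [graphHPrime_adj_inl_inr]
  rw [← card_neighborFinset_eq_degree, this, card_erase_of_mem (mem_univ _)]
  simp
  omega

lemma graphHPrime_degree_inr (j : Fin (n - a)) :
    (graphHPrime a n G₀).degree (.inr j) = a + G₀.degree j := by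
  have : (graphHPrime a n G₀).neighborFinset (.inr j) =
      (univ : Finset (Fin a)).disjSum (G₀.neighborFinset j) := by
    ext v
    rcases v with i | i
    · simp [graphHPrime_adj_inr_inl]
    · simp [graphHPrime_adj_inr_inr]
  rw [← card_neighborFinset_eq_degree, this, card_disjSum]
  simp

lemma degreePowerSum_graphHPrime (r : ℕ) (han : a ≤ n) :
    degreePowerSum r (graphHPrime a n G₀) =
      a * (n - 1) ^ r + ∑ j, (a + G₀.degree j) ^ r := by
  simp [degreePowerSum, graphHPrime_degree_inl han, graphHPrime_degree_inr]

lemma graphHPrime_free {s t : ℕ} (hs : 1 ≤ s) (hst : s ≤ t) {G₀ : SimpleGraph (Fin (n - (s - 1)))}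
    (hG : NoShortCycle G₀) (hdeg : ∀ v, G₀.degree v < t) :
    (completeBipartiteGraph (Fin s) (Fin t)).Free (graphHPrime (s - 1) n G₀) := by
  rw [SimpleGraph.Free, completeBipartiteGraph_isContained_iff]
  rintro ⟨L, R, hL, hR, hLR⟩
  have hLR : ∀ x ∈ L, ∀ y ∈ R, (graphHPrime (s - 1) n G₀).Adj x y := fun x hx y hy => hLR hx hy
  rw [Fintype.card_fin] at hL hR
  have h1 : #L.toLeft + #R.toLeft ≤ s - 1 := by
    have hd : Disjoint L.toLeft R.toLeft := by
      rw [Finset.disjoint_left]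
      intro i hi hj
      simp only [mem_toLeft] at hi hj
      exact (hLR _ hi _ hj).ne rfl
    rw [← card_union_of_disjoint hd]
    simpa using card_le_univ (L.toLeft ∪ R.toLeft)
  have h2 := card_toLeft_add_card_toRight (u := L)
  have h3 := card_toLeft_add_card_toRight (u := R)
  have hadj : ∀ i ∈ L.toRight, ∀ j ∈ R.toRight, G₀.Adj i j := by
    intro i hi j hj
    simp only [mem_toRight] at hi hj
    exact graphHPrime_adj_inr_inr.1 (hLR _ hi _ hj)
  -- The clique absorbs at most s - 1 vertices of the biclique, so both sides leave a vertex in `G₀`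
  -- (for the larger side because s ≤ t). Two or more on each side give a 4-cycle; a single one on
  -- some side forces t vertices on the other, hence a vertex of degree at least t in `G₀`.
  by_cases hp : 1 < #L.toRight
  · by_cases hq : 1 < #R.toRight
    · obtain ⟨p, hp, p', hp', hpp⟩ := one_lt_card.1 hp
      obtain ⟨q, hq, q', hq', hqq⟩ := one_lt_card.1 hq
      exact hG.square p q p' q' (hadj _ hp _ hq) (hadj _ hp' _ hq).symm (hadj _ hp' _ hq')
        (hadj _ hp _ hq').symm hpp hqq
    · obtain ⟨q, hq⟩ : R.toRight.Nonempty := card_pos.1 (by omega)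
      have : #L.toRight ≤ G₀.degree q := by
        rw [← card_neighborFinset_eq_degree]
        exact card_le_card fun i hi => by simpa using (hadj i hi q hq).symm
      have := hdeg q
      omega
  · obtain ⟨p, hp⟩ : L.toRight.Nonempty := card_pos.1 (by omega)
    have : #R.toRight ≤ G₀.degree p := by
      rw [← card_neighborFinset_eq_degree]
      exact card_le_card fun i hi => by simpa using hadj p hp i hi
    have := hdeg p
    omega

lemma degreePowerSum_le_exDegreePower {r n : ℕ} {V W : Type*} [Fintype V] {F : SimpleGraph W}
    {G : SimpleGraph V} (hV : Fintype.card V = n) (hG : F.Free G) :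
    degreePowerSum r G ≤ exDegreePower r n F := by
  let e : G ≃g G.map (Fintype.equivFinOfCardEq hV).toEmbedding :=
    Iso.map (Fintype.equivFinOfCardEq hV) G
  rw [degreePowerSum_congr r e]
  exact le_sup (f := fun G => degreePowerSum r G) (by simpa using (free_congr_right e).1 hG)

end JoinGraph

/-! ### Inequalities for powers and falling factorials -/

section Arithmetic

/-- The leading term has coefficient exactly 1, which the comparison with (s - 1)n^r requires; the
cruder bounds with factor t^t serve only for error terms. -/
lemma pow_succ_le_mul_descFactorial_add (d k : ℕ) :
    d ^ (k + 1) ≤ d * d.descFactorial k + k ^ 2 * d ^ k := by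
  induction k with
  | zero => simp
  | succ k ih =>
    have h1 : d * d.descFactorial k ≤ d.descFactorial (k + 1) + k * d ^ k := by
      have h := Nat.mul_le_mul_left k (Nat.descFactorial_le_pow d k)
      rw [Nat.descFactorial_succ]
      calc d * d.descFactorial k ≤ ((d - k) + k) * d.descFactorial k :=
            Nat.mul_le_mul_right _ (by omega)
        _ = (d - k) * d.descFactorial k + k * d.descFactorial k := by ring
        _ ≤ _ := by omega
    calc d ^ (k + 1 + 1) = d * d ^ (k + 1) := by ring
      _ ≤ d * (d * d.descFactorial k + k ^ 2 * d ^ k) := Nat.mul_le_mul_left _ ih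
      _ ≤ d * (d.descFactorial (k + 1) + k * d ^ k + k ^ 2 * d ^ k) := by gcongr
      _ = d * d.descFactorial (k + 1) + (k + k ^ 2) * d ^ (k + 1) := by ring
      _ ≤ d * d.descFactorial (k + 1) + (k + 1) ^ 2 * d ^ (k + 1) := by
        gcongr
        nlinarith

lemma pow_le_mul_descFactorial {d t : ℕ} (ht : 1 ≤ t) (h : t ≤ d) :
    d ^ t ≤ t ^ t * d.descFactorial t := by
  have h1 : d ≤ t * (d + 1 - t) := by
    obtain ⟨e, rfl⟩ := Nat.exists_eq_add_of_le h
    have : t + e + 1 - t = e + 1 := by omega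
    rw [this]
    nlinarith
  calc d ^ t ≤ (t * (d + 1 - t)) ^ t := Nat.pow_le_pow_left h1 t
    _ = t ^ t * (d + 1 - t) ^ t := mul_pow _ _ _
    _ ≤ _ := Nat.mul_le_mul_left _ (Nat.pow_sub_le_descFactorial d t)

lemma pow_le_mul_descFactorial_add_one {d t : ℕ} (ht : 1 ≤ t) :
    d ^ t ≤ t ^ t * (d.descFactorial t + 1) := by
  rcases le_total t d with h | h
  · exact (pow_le_mul_descFactorial ht h).trans (Nat.mul_le_mul_left _ (Nat.le_succ _))
  · exact (Nat.pow_le_pow_left h t).trans (Nat.le_mul_of_pos_right _ (Nat.succ_pos _))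

/-- Each unit of degree missing from N costs at least N^(r-1). -/
lemma pow_add_sub_mul_pow_le {d N r : ℕ} (hr : 1 ≤ r) (h : d ≤ N) :
    d ^ r + (N - d) * N ^ (r - 1) ≤ N ^ r := by
  obtain ⟨k, rfl⟩ := Nat.exists_eq_add_of_le' hr
  rw [Nat.add_sub_cancel]
  calc d ^ (k + 1) + (N - d) * N ^ k = d * d ^ k + (N - d) * N ^ k := by ring
    _ ≤ d * N ^ k + (N - d) * N ^ k := by gcongr
    _ = (d + (N - d)) * N ^ k := by ring
    _ = N ^ (k + 1) := by rw [Nat.add_sub_cancel' h]; ring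

lemma pow_le_sub_one_pow_add (n r : ℕ) : n ^ r ≤ (n - 1) ^ r + r * n ^ (r - 1) := by
  rcases n with _ | n
  · rcases r with _ | r <;> simp
  induction r with
  | zero => simp
  | succ r ih =>
    simp only [Nat.add_sub_cancel] at ih ⊢
    have h1 : n ^ r ≤ (n + 1) ^ r := Nat.pow_le_pow_left (by omega) r
    have h2 : n * (r * (n + 1) ^ (r - 1)) ≤ r * (n + 1) ^ r := by
      rcases r with _ | r
      · simp
      · simp only [Nat.add_sub_cancel]
        calc n * ((r + 1) * (n + 1) ^ r) ≤ (n + 1) * ((r + 1) * (n + 1) ^ r) := by gcongr; omega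
          _ = _ := by ring
    calc (n + 1) ^ (r + 1) = n * (n + 1) ^ r + (n + 1) ^ r := by ring
      _ ≤ n * (n ^ r + r * (n + 1) ^ (r - 1)) + (n + 1) ^ r := by gcongr
      _ = n ^ (r + 1) + n * (r * (n + 1) ^ (r - 1)) + (n + 1) ^ r := by ring
      _ ≤ n ^ (r + 1) + r * (n + 1) ^ r + (n + 1) ^ r := by gcongr
      _ = _ := by ring

/-- Intended for d a degree, e the number of neighbours in a set of size b, and c a bound on the
other neighbours. The falling factorial can then be summed over vertices by counting bicliques. -/
lemma pow_le_add_mul_descFactorial {r t c d b e : ℕ} (ht : 1 ≤ t) (htr : t ≤ r) (hd : d ≤ c + e)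
    (he : e ≤ b) :
    d ^ r ≤ (c + t) ^ r + (c + 1) ^ r * t ^ t * b ^ (r - t) * e.descFactorial t := by
  rcases lt_or_ge e t with h | h
  · exact (Nat.pow_le_pow_left (by omega) r).trans (Nat.le_add_right _ _)
  · have h1 : d ≤ (c + 1) * e := by nlinarith
    calc d ^ r ≤ ((c + 1) * e) ^ r := Nat.pow_le_pow_left h1 r
      _ = (c + 1) ^ r * e ^ (r - t) * e ^ t := by
        rw [mul_pow, mul_assoc, ← pow_add, Nat.sub_add_cancel htr]
      _ ≤ (c + 1) ^ r * b ^ (r - t) * (t ^ t * e.descFactorial t) := by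
        gcongr
        exact pow_le_mul_descFactorial ht h
      _ = (c + 1) ^ r * t ^ t * b ^ (r - t) * e.descFactorial t := by ring
      _ ≤ _ := Nat.le_add_left _ _

/-- If h has an exceptional index, its even sum is one less than d times the number of indices. So g
cannot equal d throughout, and some value of g is at most d - 1. -/
lemma sum_pow_le_sum_pow_of_even {ι κ : Type*} [Fintype κ] {A : Finset ι} {g : ι → ℕ} {h : κ → ℕ}
    {a d r : ℕ} (hcard : #A = Fintype.card κ) (hd : 1 ≤ d) (hg : ∀ v ∈ A, g v ≤ d)
    (hgeven : Even (∑ v ∈ A, g v)) (hheven : Even (∑ j, h j))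
    (hh : (∀ j, h j = d) ∨ ∃ u, h u = d - 1 ∧ ∀ j, j ≠ u → h j = d) :
    ∑ v ∈ A, (a + g v) ^ r ≤ ∑ j, (a + h j) ^ r := by
  rcases hh with hh | ⟨u, hu, hh⟩
  · calc ∑ v ∈ A, (a + g v) ^ r ≤ ∑ v ∈ A, (a + d) ^ r :=
          sum_le_sum fun v hv => Nat.pow_le_pow_left (by have := hg v hv; omega) r
      _ = ∑ j, (a + h j) ^ r := by simp [hh, hcard]
  · have hsplit : ∀ f : ℕ → ℕ, ∑ j, f (h j) = f (d - 1) + (Fintype.card κ - 1) * f d := by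
      intro f
      rw [← add_sum_erase _ _ (mem_univ u), hu]
      congr 1
      rw [sum_congr rfl fun j hj => by rw [hh j (ne_of_mem_erase hj)], sum_const,
        card_erase_of_mem (mem_univ u), smul_eq_mul, card_univ]
    have hpos : 0 < Fintype.card κ := Fintype.card_pos_iff.2 ⟨u⟩
    obtain ⟨w, hw, hwd⟩ : ∃ w ∈ A, g w < d := by
      by_contra! hcon
      have h1 : ∑ v ∈ A, g v = Fintype.card κ * d := by
        rw [sum_congr rfl fun v hv => le_antisymm (hg v hv) (hcon v hv), sum_const, hcard,
          smul_eq_mul]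
      have h2 := hsplit id
      simp only [id] at h2
      have h3 : ∑ v ∈ A, g v = ∑ j, h j + 1 := by
        rw [h1, h2]
        obtain ⟨m, hm⟩ := Nat.exists_eq_add_of_le' hpos
        rw [hm, Nat.add_sub_cancel, Nat.add_mul]
        omega
      rw [h3] at hgeven
      exact (Nat.even_add_one.1 hgeven) hheven
    rw [hsplit fun x => (a + x) ^ r, ← add_sum_erase _ _ hw]
    refine Nat.add_le_add (Nat.pow_le_pow_left (by omega) r) ?_
    rw [← hcard, ← card_erase_of_mem hw, ← smul_eq_mul]
    exact sum_le_card_nsmul _ _ _ fun v hv =>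
      Nat.pow_le_pow_left (by have := hg v (mem_of_mem_erase hv); omega) r

end Arithmetic

/-! ### The upper bound for `K_{s,t}`-free graphs -/

section UpperBound
variable {V : Type*}

/-- No set of `s` vertices is completely joined to a set of `t` vertices. -/
def NoBiclique (s t : ℕ) (G : SimpleGraph V) : Prop :=
  ∀ L R : Finset V, #L = s → #R = t → (∀ x ∈ L, ∀ y ∈ R, G.Adj x y) → False

variable {G : SimpleGraph V} {s t r : ℕ}

lemma noBiclique_of_free (h : (completeBipartiteGraph (Fin s) (Fin t)).Free G) : NoBiclique s t G := by
  intro L R hL hR hLR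
  apply h
  rw [completeBipartiteGraph_isContained_iff]
  exact ⟨L, R, by simpa, by simpa, fun x hx y hy => hLR x hx y hy⟩

lemma NoBiclique.card_lt (hG : NoBiclique s t G) {L R : Finset V} (hL : s ≤ #L)
    (hLR : ∀ x ∈ L, ∀ y ∈ R, G.Adj x y) : #R < t := by
  by_contra! h
  obtain ⟨L', hL', hL2⟩ := exists_subset_card_eq hL
  obtain ⟨R', hR', hR2⟩ := exists_subset_card_eq h
  exact hG L' R' hL2 hR2 fun x hx y hy => hLR x (hL' hx) y (hR' hy)

variable [Fintype V]

/-- The set of vertices adjacent to all vertices of `U`. -/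
noncomputable def commonNbrs (G : SimpleGraph V) (U : Finset V) : Finset V :=
  {v | ∀ u ∈ U, G.Adj u v}

/-- The set of vertices outside `U` that are not adjacent to all vertices of `U`. -/
noncomputable def deficient (G : SimpleGraph V) (U : Finset V) : Finset V :=
  {v | v ∉ U ∧ ∃ u ∈ U, ¬ G.Adj u v}

/-- Double counting: each t-subset of B lies in the neighbourhoods of at most s - 1 vertices. -/
lemma NoBiclique.sum_descFactorial_le (hG : NoBiclique s t G) (hs : 1 ≤ s) (B : Finset V) :
    ∑ v, (#(G.neighborFinset v ∩ B)).descFactorial t ≤ (s - 1) * #B ^ t := by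
  have h1 : ∑ v, (#(G.neighborFinset v ∩ B)).choose t ≤ (s - 1) * (#B).choose t := by
    calc ∑ v, (#(G.neighborFinset v ∩ B)).choose t
        = ∑ v, #{T ∈ powersetCard t B | T ⊆ G.neighborFinset v} := by
          refine sum_congr rfl fun v _ => ?_
          rw [← card_powersetCard]
          congr 1
          ext T
          simp only [mem_powersetCard, mem_filter, subset_inter_iff]
          tauto
      _ = ∑ T ∈ powersetCard t B, #{v | T ⊆ G.neighborFinset v} :=
          sum_card_bipartiteAbove_eq_sum_card_bipartiteBelow
            (fun (v : V) (T : Finset V) => T ⊆ G.neighborFinset v)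
      _ ≤ ∑ T ∈ powersetCard t B, (s - 1) := by
          refine sum_le_sum fun T hT => ?_
          by_contra! hcon
          have := hG.card_lt (L := {v | T ⊆ G.neighborFinset v}) (R := T) (by omega)
            (fun x hx y hy => by simpa using (mem_filter.1 hx).2 hy)
          have := (mem_powersetCard.1 hT).2
          omega
      _ = (s - 1) * (#B).choose t := by
          rw [sum_const, card_powersetCard, smul_eq_mul, mul_comm]
  calc ∑ v, (#(G.neighborFinset v ∩ B)).descFactorial t
      = t.factorial * ∑ v, (#(G.neighborFinset v ∩ B)).choose t := by
        simp only [Nat.descFactorial_eq_factorial_mul_choose, mul_sum]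
    _ ≤ t.factorial * ((s - 1) * (#B).choose t) := Nat.mul_le_mul_left _ h1
    _ = (s - 1) * (#B).descFactorial t := by
        rw [Nat.descFactorial_eq_factorial_mul_choose]; ring
    _ ≤ _ := Nat.mul_le_mul_left _ (Nat.descFactorial_le_pow _ _)

lemma NoBiclique.sum_descFactorial_degree_le (hG : NoBiclique s t G) (hs : 1 ≤ s) :
    ∑ v, (G.degree v).descFactorial t ≤ (s - 1) * Fintype.card V ^ t := by
  simpa using hG.sum_descFactorial_le hs univ

/-- If at most `s - 2` vertices have degree at least `(1 - 1 / M) n`, then the degree power sum is at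
most `(s - 1) (n - 1) ^ r`. -/
lemma NoBiclique.degreePowerSum_le_of_card_lt (hG : NoBiclique s t G) (hs : 1 ≤ s) (ht : 1 ≤ t)
    (htr : t < r) {M : ℕ} (hM : 1 ≤ M)
    (hU : #{v | M * Fintype.card V ≤ M * G.degree v + Fintype.card V} < s - 1)
    (hn : M * (t ^ 2 * (t ^ t * s)) + M * (s - 1) * r ≤ Fintype.card V) :
    degreePowerSum r G ≤ (s - 1) * (Fintype.card V - 1) ^ r := by
  set n := Fintype.card V with hn'
  set U : Finset V := {v | M * n ≤ M * G.degree v + n} with hUdef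
  obtain ⟨S, rfl⟩ := Nat.exists_eq_add_of_le' hs
  obtain ⟨M, rfl⟩ := Nat.exists_eq_add_of_le' hM
  simp only [Nat.add_sub_cancel] at *
  have hdn : ∀ v, G.degree v ≤ n := fun v => (G.degree_lt_card_verts v).le
  set f : V → ℕ := fun v => (G.degree v).descFactorial t with hf
  have hfn : ∀ v, f v ≤ n ^ t := fun v =>
    (Nat.descFactorial_le_pow _ _).trans (Nat.pow_le_pow_left (hdn v) t)
  have hsum : ∑ v, f v ≤ S * n ^ t := by
    simpa using hG.sum_descFactorial_degree_le (by omega)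
  -- M + 1 now plays the role of M. A degree outside `U` is at most nM/(M+1); a vertex of `U` may
  -- exceed that by n/(M+1), weighted by f v ≤ n^t.
  have h1 : (M + 1) * ∑ v, G.degree v * f v ≤ M * n * ∑ v, f v + #U * (n * n ^ t) := by
    have : #U * (n * n ^ t) = ∑ v, if v ∈ U then n * n ^ t else 0 := by
      simp
    rw [this, mul_sum, mul_sum, ← sum_add_distrib]
    refine sum_le_sum fun v _ => ?_
    split_ifs with hv
    · calc (M + 1) * (G.degree v * f v) = M * (G.degree v * f v) + G.degree v * f v := by ring
        _ ≤ M * (n * f v) + n * n ^ t := by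
          gcongr
          · exact hdn v
          · exact hdn v
          · exact hfn v
        _ = _ := by ring
    · have hv' : (M + 1) * G.degree v + n < (M + 1) * n := by
        simpa [hUdef] using hv
      have hv2 : (M + 1) * G.degree v ≤ M * n := by
        have : (M + 1) * n = M * n + n := by ring
        omega
      calc (M + 1) * (G.degree v * f v) = (M + 1) * G.degree v * f v := by ring
        _ ≤ M * n * f v := Nat.mul_le_mul_right _ hv2
        _ ≤ _ := by omega
  -- Since #U + 1 ≤ S, a whole n^(t+1) is saved; after scaling by n^(r-t-1) it pays for all the
  -- lower-order errors.
  have h2 : (M + 1) * ∑ v, G.degree v * f v + n ^ (t + 1) ≤ (M + 1) * S * n ^ (t + 1) := by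
    calc (M + 1) * ∑ v, G.degree v * f v + n ^ (t + 1)
        ≤ M * n * (S * n ^ t) + #U * (n * n ^ t) + n ^ (t + 1) := by
          have := Nat.mul_le_mul_left (M * n) hsum
          omega
      _ = (M * S + (#U + 1)) * n ^ (t + 1) := by ring
      _ ≤ (M * S + S) * n ^ (t + 1) := Nat.mul_le_mul_right _ (by omega)
      _ = _ := by ring
  have h3 : ∑ v, G.degree v ^ t ≤ t ^ t * (S + 1) * n ^ t := by
    calc ∑ v, G.degree v ^ t ≤ ∑ v, t ^ t * (f v + 1) :=
          sum_le_sum fun v _ => pow_le_mul_descFactorial_add_one ht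
      _ = t ^ t * (∑ v, f v + n) := by
          rw [← mul_sum, sum_add_distrib]
          simp [hn']
      _ ≤ t ^ t * (S * n ^ t + n ^ t) := by
          gcongr
          exact Nat.le_self_pow (by omega) n
      _ = _ := by ring
  have h4 : ∑ v, G.degree v ^ (t + 1) ≤
      ∑ v, G.degree v * f v + t ^ 2 * (t ^ t * (S + 1) * n ^ t) := by
    calc ∑ v, G.degree v ^ (t + 1) ≤ ∑ v, (G.degree v * f v + t ^ 2 * G.degree v ^ t) :=
          sum_le_sum fun v _ => pow_succ_le_mul_descFactorial_add _ _
      _ = ∑ v, G.degree v * f v + t ^ 2 * ∑ v, G.degree v ^ t := by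
          rw [sum_add_distrib, ← mul_sum]
      _ ≤ _ := by gcongr
  obtain ⟨k, rfl⟩ := Nat.exists_eq_add_of_lt htr
  have h5 : degreePowerSum (t + k + 1) G ≤ n ^ k * ∑ v, G.degree v ^ (t + 1) := by
    rw [degreePowerSum, mul_sum]
    refine sum_le_sum fun v _ => ?_
    calc G.degree v ^ (t + k + 1) = G.degree v ^ k * G.degree v ^ (t + 1) := by ring
      _ ≤ _ := Nat.mul_le_mul_right _ (Nat.pow_le_pow_left (hdn v) k)
  set r := t + k + 1 with hr
  have h6 : (M + 1) * degreePowerSum r G + n ^ r ≤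
      (M + 1) * S * n ^ r + (M + 1) * (t ^ 2 * (t ^ t * (S + 1))) * n ^ (r - 1) := by
    have e1 : n ^ r = n ^ k * n ^ (t + 1) := by rw [hr]; ring
    have e2 : n ^ (r - 1) = n ^ k * n ^ t := by rw [hr, Nat.add_sub_cancel]; ring
    rw [e1, e2]
    calc (M + 1) * degreePowerSum r G + n ^ k * n ^ (t + 1)
        ≤ (M + 1) * (n ^ k * (∑ v, G.degree v * f v + t ^ 2 * (t ^ t * (S + 1) * n ^ t))) +
          n ^ k * n ^ (t + 1) := by
          gcongr
          exact h5.trans (Nat.mul_le_mul_left _ h4)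
      _ = n ^ k * ((M + 1) * ∑ v, G.degree v * f v + n ^ (t + 1)) +
          (M + 1) * (t ^ 2 * (t ^ t * (S + 1))) * (n ^ k * n ^ t) := by ring
      _ ≤ n ^ k * ((M + 1) * S * n ^ (t + 1)) +
          (M + 1) * (t ^ 2 * (t ^ t * (S + 1))) * (n ^ k * n ^ t) := by gcongr
      _ = _ := by ring
  have h7 : (M + 1) * S * n ^ r ≤ (M + 1) * S * ((n - 1) ^ r + r * n ^ (r - 1)) :=
    Nat.mul_le_mul_left _ (pow_le_sub_one_pow_add n r)
  have h8 : ((M + 1) * (t ^ 2 * (t ^ t * (S + 1))) + (M + 1) * S * r) * n ^ (r - 1) ≤ n ^ r := by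
    calc _ ≤ n * n ^ (r - 1) := Nat.mul_le_mul_right _ hn
      _ = n ^ r := by rw [hr, Nat.add_sub_cancel]; ring
  refine le_of_mul_le_mul_left (a := M + 1) ?_ (Nat.succ_pos M)
  nlinarith

/-- Any s vertices of U together miss at most sn/M ≤ n/2 vertices, leaving at least n/2 ≥ t common
neighbours. -/
lemma NoBiclique.card_lt_of_large_degrees (hG : NoBiclique s t G) {M : ℕ} (hM : 2 * s ≤ M)
    (hM0 : 1 ≤ M) {U : Finset V}
    (hU : ∀ v ∈ U, M * Fintype.card V ≤ M * G.degree v + Fintype.card V)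
    (hn : 2 * t ≤ Fintype.card V) : #U < s := by
  by_contra! hcon
  obtain ⟨L, hLU, hL⟩ := exists_subset_card_eq hcon
  have h1 : #(commonNbrs G L) < t :=
    hG.card_lt (L := L) hL.ge fun x hx y hy => (mem_filter.1 hy).2 x hx
  set n := Fintype.card V
  have h2 : n ≤ #(commonNbrs G L) + ∑ u ∈ L, (n - G.degree u) := by
    calc n = #(univ : Finset V) := card_univ.symm
      _ ≤ #(commonNbrs G L ∪ L.biUnion fun u => (G.neighborFinset u)ᶜ) := by
          refine card_le_card fun v _ => ?_
          simp only [mem_union, commonNbrs, mem_filter, mem_univ, true_and, mem_biUnion,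
            mem_compl, mem_neighborFinset]
          by_contra! h
          grind
      _ ≤ #(commonNbrs G L) + ∑ u ∈ L, #(G.neighborFinset u)ᶜ :=
          (card_union_le _ _).trans (Nat.add_le_add_left card_biUnion_le _)
      _ = _ := by simp [card_compl, n]
  have h3 : M * ∑ u ∈ L, (n - G.degree u) ≤ s * n := by
    rw [mul_sum, ← hL, ← smul_eq_mul (#L)]
    refine sum_le_card_nsmul _ _ _ fun u hu => ?_
    have := hU u (hLU hu)
    rw [Nat.mul_sub]
    omega
  have h4 : M * n ≤ M * #(commonNbrs G L) + s * n := by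
    have := Nat.mul_le_mul_left M h2
    rw [mul_add] at this
    omega
  have h5 : 2 * (s * n) ≤ M * n := by
    have := Nat.mul_le_mul_right n hM
    linarith
  have h6 : M * n ≤ M * (2 * #(commonNbrs G L)) := by linarith
  have := Nat.le_of_mul_le_mul_left h6 (by omega)
  omega

lemma card_deficient_le (G : SimpleGraph V) (U : Finset V) :
    #(deficient G U) ≤ ∑ u ∈ U, (Fintype.card V - 1 - G.degree u) := by
  calc #(deficient G U) ≤ #(U.biUnion fun u => Gᶜ.neighborFinset u) := by
        refine card_le_card fun v hv => ?_
        obtain ⟨h1, u, hu, h2⟩ := (mem_filter.1 hv).2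
        simp only [mem_biUnion, mem_neighborFinset, compl_adj]
        exact ⟨u, hu, fun h => h1 (h ▸ hu), h2⟩
    _ ≤ ∑ u ∈ U, #(Gᶜ.neighborFinset u) := card_biUnion_le
    _ = _ := by
        refine sum_congr rfl fun u _ => ?_
        rw [card_neighborFinset_eq_degree, degree_compl]

lemma sum_degree_pow_add_le (hr : 1 ≤ r) (U : Finset V) :
    ∑ u ∈ U, G.degree u ^ r + #(deficient G U) * (Fintype.card V - 1) ^ (r - 1) ≤
      #U * (Fintype.card V - 1) ^ r := by
  calc _ ≤ ∑ u ∈ U, G.degree u ^ r +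
        (∑ u ∈ U, (Fintype.card V - 1 - G.degree u)) * (Fintype.card V - 1) ^ (r - 1) := by
        gcongr
        exact card_deficient_le G U
    _ = ∑ u ∈ U, (G.degree u ^ r +
        (Fintype.card V - 1 - G.degree u) * (Fintype.card V - 1) ^ (r - 1)) := by
        rw [sum_add_distrib, sum_mul]
    _ ≤ _ := by
        rw [← smul_eq_mul]
        refine sum_le_card_nsmul _ _ _ fun u _ => pow_add_sub_mul_pow_le hr ?_
        have := G.degree_lt_card_verts u
        omega

lemma NoBiclique.card_inter_commonNbrs_lt (hG : NoBiclique s t G) {U : Finset V}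
    (hU : #U + 1 = s) {v : V} (hv : v ∉ U) : #(G.neighborFinset v ∩ commonNbrs G U) < t := by
  refine hG.card_lt (L := insert v U) (by rw [card_insert_of_notMem hv]; omega) ?_
  intro x hx y hy
  simp only [mem_inter, mem_neighborFinset, commonNbrs, mem_filter, mem_univ, true_and] at hy
  rcases mem_insert.1 hx with rfl | hx
  · exact hy.1
  · exact hy.2 x hx

/-- The neighbours of v lie in U, among the fewer than t common neighbours of U, or in the deficient
set. -/
lemma NoBiclique.degree_le (hG : NoBiclique s t G) {U : Finset V}
    (hU : #U + 1 = s) {v : V} (hv : v ∉ U) :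
    G.degree v ≤ s + t + #(G.neighborFinset v ∩ deficient G U) := by
  have h1 := hG.card_inter_commonNbrs_lt hU hv
  have h2 : G.neighborFinset v ⊆ (U ∪ (G.neighborFinset v ∩ commonNbrs G U)) ∪
      (G.neighborFinset v ∩ deficient G U) := by
    intro w hw
    simp only [mem_union, mem_inter, hw, true_and, commonNbrs, deficient, mem_filter, mem_univ]
    by_contra! h
    grind
  have h3 := card_le_card h2
  have h4 := card_union_le (U ∪ (G.neighborFinset v ∩ commonNbrs G U))
    (G.neighborFinset v ∩ deficient G U)
  have h5 := card_union_le U (G.neighborFinset v ∩ commonNbrs G U)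
  rw [card_neighborFinset_eq_degree] at h3
  omega

lemma NoBiclique.sum_compl_degree_pow_le (hG : NoBiclique s t G) (hs : 1 ≤ s) (ht : 1 ≤ t)
    (htr : t ≤ r) {U : Finset V} (hU : #U + 1 = s) :
    ∑ v ∈ Uᶜ, G.degree v ^ r ≤ (s + t + t) ^ r * Fintype.card V +
      (s + t + 1) ^ r * t ^ t * (s - 1) * #(deficient G U) ^ r := by
  set b := #(deficient G U)
  calc ∑ v ∈ Uᶜ, G.degree v ^ r
      ≤ ∑ v ∈ Uᶜ, ((s + t + t) ^ r + (s + t + 1) ^ r * t ^ t * b ^ (r - t) *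
          (#(G.neighborFinset v ∩ deficient G U)).descFactorial t) := by
        refine sum_le_sum fun v hv => ?_
        exact pow_le_add_mul_descFactorial ht htr (hG.degree_le hU (by simpa using hv))
          (card_le_card inter_subset_right)
    _ ≤ ∑ v, ((s + t + t) ^ r + (s + t + 1) ^ r * t ^ t * b ^ (r - t) *
          (#(G.neighborFinset v ∩ deficient G U)).descFactorial t) :=
        sum_le_sum_of_subset (subset_univ _)
    _ = (s + t + t) ^ r * Fintype.card V + (s + t + 1) ^ r * t ^ t * b ^ (r - t) *
          ∑ v, (#(G.neighborFinset v ∩ deficient G U)).descFactorial t := by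
        rw [sum_add_distrib, ← mul_sum, sum_const, card_univ, smul_eq_mul, mul_comm]
    _ ≤ (s + t + t) ^ r * Fintype.card V + (s + t + 1) ^ r * t ^ t * b ^ (r - t) *
          ((s - 1) * b ^ t) := by
        gcongr
        exact hG.sum_descFactorial_le hs _
    _ = (s + t + t) ^ r * Fintype.card V +
          (s + t + 1) ^ r * t ^ t * (s - 1) * (b ^ (r - t) * b ^ t) := by ring
    _ = _ := by rw [← pow_add, Nat.sub_add_cancel htr]

/-- If all of the `s - 1` vertices of `U` have degree close to `n`, but some vertex outside `U` is
not adjacent to all of them, then the degree power sum is at most `(s - 1) (n - 1) ^ r`. -/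
lemma NoBiclique.degreePowerSum_le_of_deficient (hG : NoBiclique s t G) (hs : 1 ≤ s) (ht : 2 ≤ t)
    (htr : t < r) {M : ℕ} {U : Finset V} (hU : #U + 1 = s) (hb : (deficient G U).Nonempty)
    (hM : 2 * ((s + t + 1) ^ r * t ^ t * (s - 1)) * (2 * s) ≤ M) (hM0 : 1 ≤ M) (hMs : 2 * s ≤ M)
    (hlarge : ∀ v ∈ U, M * Fintype.card V ≤ M * G.degree v + Fintype.card V)
    (hn : 4 * (s + t + t) ^ r + 2 ≤ Fintype.card V) :
    degreePowerSum r G ≤ (s - 1) * (Fintype.card V - 1) ^ r := by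
  have h1 := hG.sum_compl_degree_pow_le hs (by omega) htr.le hU
  have h2 := sum_degree_pow_add_le (G := G) (r := r) (by omega) U
  have h3 := card_deficient_le G U
  have hb1 : 1 ≤ #(deficient G U) := card_pos.2 hb
  set b := #(deficient G U)
  set n := Fintype.card V
  set C₁ := (s + t + t) ^ r
  set C₂ := (s + t + 1) ^ r * t ^ t * (s - 1)
  have hUs : #U = s - 1 := by omega
  obtain ⟨N, hN⟩ : ∃ N, n = N + 1 := ⟨n - 1, by omega⟩
  obtain ⟨k, hk⟩ : ∃ k, r = k + 3 := ⟨r - 3, by omega⟩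
  have hMb : M * b ≤ s * n := by
    have h : M * ∑ u ∈ U, (n - 1 - G.degree u) ≤ #U * n := by
      rw [mul_sum, ← smul_eq_mul (#U)]
      refine sum_le_card_nsmul _ _ _ fun u hu => ?_
      have := hlarge u hu
      have h' : M * (n - 1 - G.degree u) ≤ M * (n - G.degree u) :=
        Nat.mul_le_mul_left _ (by omega)
      rw [Nat.mul_sub M n] at h'
      omega
    calc M * b ≤ _ := Nat.mul_le_mul_left _ h3
      _ ≤ #U * n := h
      _ ≤ s * n := Nat.mul_le_mul_right _ (by omega)
  rw [hUs] at h2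
  simp only [hN, Nat.add_sub_cancel] at h1 h2 hMb hn ⊢
  have hMb' : M * b ≤ 2 * s * N := by
    have : s * (N + 1) ≤ s * (2 * N) := Nat.mul_le_mul_left _ (by omega)
    linarith
  -- The loss b * N^(r-1) is split into halves, one for each error term. Here r ≥ 3 makes N^(r-1) at
  -- least quadratic in N.
  have h4 : 2 * (C₁ * (N + 1)) ≤ b * N ^ (r - 1) := by
    calc 2 * (C₁ * (N + 1)) ≤ 2 * (C₁ * (2 * N)) := by gcongr; omega
      _ = 4 * C₁ * N := by ring
      _ ≤ N * N := by gcongr; omega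
      _ = N ^ 2 := by ring
      _ ≤ N ^ (r - 1) := Nat.pow_le_pow_right (by omega) (by omega)
      _ ≤ b * N ^ (r - 1) := Nat.le_mul_of_pos_left _ hb1
  have h5 : 2 * (C₂ * b ^ r) ≤ b * N ^ (r - 1) := by
    -- One factor M absorbs 2 * C₂ * (2 * s); each remaining factor absorbs 2 * s.
    have hMp : 2 * C₂ * (2 * s) ^ (r - 1) ≤ M ^ (r - 1) := by
      calc 2 * C₂ * (2 * s) ^ (r - 1) = 2 * C₂ * (2 * s) * (2 * s) ^ (k + 1) := by
            rw [hk, show k + 3 - 1 = k + 1 + 1 by omega]; ring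
        _ ≤ M * M ^ (k + 1) := by gcongr
        _ = M ^ (r - 1) := by rw [hk, show k + 3 - 1 = k + 1 + 1 by omega]; ring
    refine le_of_mul_le_mul_left (a := M ^ (r - 1)) ?_ (by positivity)
    calc M ^ (r - 1) * (2 * (C₂ * b ^ r)) = 2 * C₂ * b * (M * b) ^ (r - 1) := by
          have : b ^ r = b * b ^ (r - 1) := by
            rw [hk, show k + 3 - 1 = k + 2 by omega]; ring
          rw [this, mul_pow]; ring
      _ ≤ 2 * C₂ * b * (2 * s * N) ^ (r - 1) := by gcongr
      _ = 2 * C₂ * (2 * s) ^ (r - 1) * (b * N ^ (r - 1)) := by rw [mul_pow (2 * s) N]; ring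
      _ ≤ _ := Nat.mul_le_mul_right _ hMp
  rw [degreePowerSum, ← sum_add_sum_compl U]
  omega

/-- Handshake lemma for `G` with all edges meeting `U` removed. -/
lemma even_sum_card_sdiff (G : SimpleGraph V) (U : Finset V) :
    Even (∑ v ∈ Uᶜ, #(G.neighborFinset v \ U)) := by
  let H : SimpleGraph V :=
    { Adj := fun a b => G.Adj a b ∧ a ∉ U ∧ b ∉ U
      symm := ⟨fun a b h => ⟨h.1.symm, h.2.2, h.2.1⟩⟩
      loopless := ⟨fun a h => h.1.ne rfl⟩ }
  have h1 : ∑ v ∈ Uᶜ, #(G.neighborFinset v \ U) = ∑ v ∈ Uᶜ, H.degree v := by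
    refine sum_congr rfl fun v hv => ?_
    rw [← card_neighborFinset_eq_degree]
    congr 1
    ext w
    have : v ∉ U := by simpa using hv
    simp [H, this]
  have h2 : ∑ v ∈ U, H.degree v = 0 := by
    refine sum_eq_zero fun v hv => ?_
    rw [← card_neighborFinset_eq_degree, card_eq_zero, eq_empty_iff_forall_notMem]
    intro w
    simp [H, hv]
  have h3 := H.sum_degrees_eq_twice_card_edges
  rw [← sum_add_sum_compl U, h2, zero_add] at h3
  rw [h1, h3]
  exact even_two_mul _

lemma NoBiclique.degreePowerSum_le_of_deficient_eq_empty (hG : NoBiclique s t G) (hr : 1 ≤ r)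
    (ht : 2 ≤ t) {U : Finset V} (hU : #U + 1 = s) (hb : deficient G U = ∅) {κ : Type*} [Fintype κ]
    {h : κ → ℕ} (hκ : Fintype.card κ = Fintype.card V - (s - 1)) (heven : Even (∑ j, h j))
    (hh : (∀ j, h j = t - 1) ∨ ∃ u, h u = t - 1 - 1 ∧ ∀ j, j ≠ u → h j = t - 1) :
    degreePowerSum r G ≤ (s - 1) * (Fintype.card V - 1) ^ r + ∑ j, (s - 1 + h j) ^ r := by
  have hUs : #U = s - 1 := by omega
  have hmem : ∀ v, v ∉ U → ∀ u ∈ U, G.Adj u v := by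
    intro v hv u hu
    by_contra hcon
    have : v ∈ deficient G U := by
      simp only [deficient, mem_filter, mem_univ, true_and]
      exact ⟨hv, u, hu, hcon⟩
    simp [hb] at this
  have hdeg : ∀ v ∈ Uᶜ, G.degree v = s - 1 + #(G.neighborFinset v \ U) := by
    intro v hv
    have hsub : U ⊆ G.neighborFinset v := fun u hu => by
      simpa using (hmem v (by simpa using hv) u hu).symm
    rw [← card_neighborFinset_eq_degree, card_sdiff_of_subset hsub, hUs]
    have := card_le_card hsub
    omega
  rw [degreePowerSum, ← sum_add_sum_compl U]
  refine Nat.add_le_add ?_ ?_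
  · rw [← hUs]
    exact (Nat.le_add_right _ _).trans (sum_degree_pow_add_le hr U)
  · rw [sum_congr rfl fun v hv => by rw [hdeg v hv]]
    refine sum_pow_le_sum_pow_of_even (d := t - 1) ?_ (by omega) ?_ (even_sum_card_sdiff G U)
      heven hh
    · rw [card_compl, hUs, hκ]
    · intro v hv
      have hv : v ∉ U := by simpa using hv
      have h1 := hG.card_inter_commonNbrs_lt hU hv
      have h2 : #(G.neighborFinset v \ U) ≤ #(G.neighborFinset v ∩ commonNbrs G U) := by
        refine card_le_card fun w hw => ?_
        simp only [mem_sdiff, mem_inter, commonNbrs, mem_filter, mem_univ, true_and] at hw ⊢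
        exact ⟨hw.1, hmem w hw.2⟩
      omega

/-- A lower bound on the number of vertices beyond which the extremal bound is valid. -/
def vertexThreshold (r s t M : ℕ) : ℕ :=
  M * (t ^ 2 * (t ^ t * s)) + M * (s - 1) * r + 2 * t + (4 * (s + t + t) ^ r + 2)

/-- The extremal bound: a graph without `K_{s,t}` has degree power sum at most that of the join of
`K_{s-1}` with an almost `(t - 1)`-regular graph whose degree sequence is `h`. -/
theorem NoBiclique.degreePowerSum_le (hG : NoBiclique s t G) (hs : 1 ≤ s) (ht : 2 ≤ t)
    (htr : t < r) {M : ℕ} (hM : 2 * ((s + t + 1) ^ r * t ^ t * (s - 1)) * (2 * s) ≤ M)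
    (hMs : 2 * s ≤ M) (hn : vertexThreshold r s t M ≤ Fintype.card V) {κ : Type*} [Fintype κ]
    {h : κ → ℕ} (hκ : Fintype.card κ = Fintype.card V - (s - 1)) (heven : Even (∑ j, h j))
    (hh : (∀ j, h j = t - 1) ∨ ∃ u, h u = t - 1 - 1 ∧ ∀ j, j ≠ u → h j = t - 1) :
    degreePowerSum r G ≤ (s - 1) * (Fintype.card V - 1) ^ r + ∑ j, (s - 1 + h j) ^ r := by
  rw [vertexThreshold] at hn
  set U : Finset V := {v | M * Fintype.card V ≤ M * G.degree v + Fintype.card V} with hUdef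
  have hlarge : ∀ v ∈ U, M * Fintype.card V ≤ M * G.degree v + Fintype.card V :=
    fun v hv => (mem_filter.1 hv).2
  have hU : #U < s := hG.card_lt_of_large_degrees hMs (by omega) hlarge (by omega)
  rcases Nat.lt_or_ge #U (s - 1) with hlt | hge
  · exact (hG.degreePowerSum_le_of_card_lt hs (by omega) htr (by omega) hlt (by omega)).trans
      (Nat.le_add_right _ _)
  have hU1 : #U + 1 = s := by omega
  rcases (deficient G U).eq_empty_or_nonempty with hb | hb
  · exact hG.degreePowerSum_le_of_deficient_eq_empty (by omega) ht hU1 hb hκ heven hh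
  · exact (hG.degreePowerSum_le_of_deficient hs ht htr hU1 hb hM (by omega) hMs hlarge
      (by omega)).trans (Nat.le_add_right _ _)

end UpperBound
end DegreePowers

open DegreePowers in
theorem proposition3 (r s t : ℕ) (hs : 1 < s) (hst : s ≤ t) (htr : t < r) :
    ∃ n₀ : ℕ, ∀ n : ℕ, n₀ ≤ n →
      (∃ G₀ : SimpleGraph (Fin (n - (s - 1))),
        DegreePowers.IsAlmostRegularGirthFive (t - 1) G₀) ∧
      ∀ G₀ : SimpleGraph (Fin (n - (s - 1))),
        DegreePowers.IsAlmostRegularGirthFive (t - 1) G₀ →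
          DegreePowers.exDegreePower r n (completeBipartiteGraph (Fin s) (Fin t)) =
            DegreePowers.degreePowerSum r (DegreePowers.graphHPrime (s - 1) n G₀) := by
  classical
  obtain ⟨M, hM, hMs⟩ : ∃ M, 2 * ((s + t + 1) ^ r * t ^ t * (s - 1)) * (2 * s) ≤ M ∧ 2 * s ≤ M :=
    ⟨_, Nat.le_add_right _ _, Nat.le_add_left _ _⟩
  -- The first two summands leave more than 2(d+1)^4 vertices, d = t - 1, once s - 1 are set aside
  -- for the clique.
  refine ⟨s + 2 * (t - 1 + 1) ^ 4 + vertexThreshold r s t M, fun n hn => ⟨?_, fun G₀ hG₀ => ?_⟩⟩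
  · exact exists_isAlmostRegularGirthFive (by omega) (by rw [Fintype.card_fin]; omega)
  obtain ⟨hgirth, hdeg⟩ := hG₀
  refine le_antisymm (Finset.sup_le fun G hG => ?_) ?_
  · have hG := noBiclique_of_free (Finset.mem_filter.1 hG).2
    have h := hG.degreePowerSum_le (r := r) (h := fun j => G₀.degree j) (by omega) (by omega) htr
      hM hMs (by rw [Fintype.card_fin]; omega) (by simp)
      (by rw [G₀.sum_degrees_eq_twice_card_edges]; exact even_two_mul _) hdeg
    rw [degreePowerSum_graphHPrime r (by omega)]
    simpa only [Fintype.card_fin] using h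
  · refine degreePowerSum_le_exDegreePower (by simp; omega) (graphHPrime_free (by omega) hst
      (noShortCycle_of_five_le_egirth hgirth) fun v => ?_)
    rcases hdeg with hdeg | ⟨u, hu, hdeg⟩
    · rw [hdeg v]
      omega
    · by_cases hv : v = u
      · rw [hv, hu]
        omega
      · rw [hdeg v hv]
        omega
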